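/- Let $q\geq 4$ be a prime power and let $\mathrm{PG}(2,q)$ be the projective plane over the finite field $\mathrm{GF}(q)$. For a set $S$ of points, call a line skew to $S$ if it contains no point of $S$, and tangent to $S$ if it contains exactly one point of $S$. The set $S$ is a blocking semioval if through every point of $S$ there is exactly one tangent to $S$ and no line is skew to $S$. Every blocking semioval $S$ in $\mathrm{PG}(2,q)$ satisfies $|S|\geq 9q/4-3$. -/

import Mathlib

open scoped LinearAlgebra.Projectivization

/-- The points of `PG(2, F)`, given by homogeneous triples over `F`. The same type serves for the
lines, a line being given by its triple of coefficients; Mathlib's incidence relation `P ∈ ℓ` on it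
says that the dot product of the two triples vanishes. -/
abbrev PG2 (F : Type*) [Field F] : Type _ := ℙ F (Fin 3 → F)

section Semiovals

variable {P L : Type*} [Membership P L]

/-- A line is skew to `S` if it contains no point of `S`. -/
def IsSkewLine (S : Set P) (l : L) : Prop := ∀ p ∈ S, p ∉ l

/-- A line is tangent to `S` if it contains exactly one point of `S`. -/
def IsTangentLine (S : Set P) (l : L) : Prop := ∃! p : P, p ∈ S ∧ p ∈ l

variable (L)

/-- `S` is a semioval if through each point of `S` there is exactly one tangent to `S`. -/
def IsSemioval (S : Set P) : Prop := ∀ p ∈ S, ∃! l : L, p ∈ l ∧ IsTangentLine S l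

/-- A blocking semioval is a semioval to which no line is skew. -/
def IsBlockingSemioval (S : Set P) : Prop := IsSemioval L S ∧ ∀ l : L, ¬ IsSkewLine S l

end Semiovals

/-! Write n for the size of S and t(Q) for the number of tangents through a point Q off S. The core
is a gap in the values of t, obtained algebraically. Take a line l through Q meeting S at least
twice. The points of S off l give a Rédei polynomial f(X, Y): its specializations in Y are indexed
by the points of l other than a point R of S on l, and the roots of each are the lines through that
point other than l. Its gcd with (X^q - X)^2 has degree 2q - t at points off S, because no line is
skew. The Szőnyi–Weiner lemma (`sum_natDegree_sub_le`) bounds how far these degrees exceed the one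
at Q and gives (3q + 1 - n)t ≤ t^2 + n - 2 (`tangentCount_quadratic`).

If 4n + 12 < 9q, this inequality fails for 3 ≤ t ≤ 3q - 2 - n, so a point with three tangents has at
least 3q - 1 - n of them. Every tangent carries such a point (`exists_three_le_tangentCount`), and
the n tangents are not covered by two of these points. A third one then exists, and since two points
share at most one tangent, 3(3q - 1 - n) - 3 ≤ n, a contradiction
(`nine_mul_order_le_of_quadratic`). -/

/-! ### Truncated resultants and the Szőnyi–Weiner lemma -/

section Resultants

open Polynomial Matrix

variable {K : Type*} [Field K]

/-- A polynomial matrix whose value at `y` has nullity at least `r` has determinant divisible by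
`(X - y) ^ r`. -/
theorem X_sub_C_pow_dvd_det {ι : Type*} [Fintype ι] [DecidableEq ι] (A : Matrix ι ι K[X]) (y : K)
    {r : ℕ} (w : Fin r → ι → K) (hw : LinearIndependent K w)
    (hker : ∀ i, (A.map (eval y)) *ᵥ w i = 0) : (X - C y) ^ r ∣ A.det := by
  classical
  let b := Module.Basis.sumExtend hw
  have : Finite (Fin r ⊕ Module.Basis.sumExtendIndex hw) := Module.Finite.finite_basis b
  have : Fintype (Module.Basis.sumExtendIndex hw) :=
    @Fintype.ofFinite _ (Finite.sum_right (Fin r))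
  let e : ι ≃ Fin r ⊕ Module.Basis.sumExtendIndex hw := (Pi.basisFun K ι).indexEquiv b
  let B : Matrix ι ι K := (Pi.basisFun K ι).toMatrix (b.reindex e.symm)
  have hB : IsUnit B.det := by
    have := (Pi.basisFun K ι).invertibleToMatrix (b.reindex e.symm)
    exact Matrix.isUnit_det_of_invertible B
  have hbl : ∀ i, b (Sum.inl i) = w i := fun i => by
    simp only [b, Module.Basis.sumExtend, Module.Basis.reindex_apply,
      Module.Basis.extend_apply_self]
    rfl
  -- In a basis extending `w`, the columns indexed by `w` vanish at `y`, so each contributes a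
  -- factor `X - C y`.
  let D : ι → K[X] := fun j => Sum.elim (fun _ => X - C y) (fun _ => 1) (e j)
  have hN : ∀ i j, ∃ c, (A * B.map C) i j = c * D j := by
    intro i j
    rcases hj : e j with a | a
    · have h0 : eval y ((A * B.map C) i j) = 0 := by
        have h1 : ∀ l, B l j = w a l := fun l => by
          simp [B, Module.Basis.toMatrix_apply, hj, hbl]
        have h2 := congrFun (hker a) i
        simpa [Matrix.mul_apply, eval_finsetSum, h1, Matrix.mulVec, dotProduct] using h2
      obtain ⟨c, hc⟩ := dvd_iff_isRoot.mpr h0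
      exact ⟨c, by rw [hc, mul_comm]; simp [D, hj]⟩
    · exact ⟨_, by simp [D, hj]; rfl⟩
  choose N hN using hN
  have h1 : A * B.map C = Matrix.of N * diagonal D := by
    ext1 i j
    rw [hN, Matrix.mul_diagonal, Matrix.of_apply]
  have h2 := congrArg Matrix.det h1
  rw [det_mul, det_mul, det_diagonal] at h2
  have h3 : ∏ j, D j = (X - C y) ^ r := by
    rw [← e.symm.prod_comp, Fintype.prod_sum_type]
    simp [D]
  have h4 : IsUnit (B.map C).det := by
    have : (B.map C).det = C B.det := (RingHom.map_det C B).symm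
    rw [this]
    exact hB.map C
  rw [h3] at h2
  exact (h4.dvd_mul_right).mp (h2 ▸ dvd_mul_left _ _)

/-- Every nonzero Leibniz term obeys the same bound, since permuting the rows leaves the sum of the
weights `ρ` unchanged. -/
theorem natDegree_det_add_le {ι : Type*} [Fintype ι] [DecidableEq ι] (A : Matrix ι ι K[X])
    (c ρ : ι → ℕ) (hA : ∀ i j, A i j = 0 ∨ (A i j).natDegree + ρ i ≤ c j) (h0 : A.det ≠ 0) :
    A.det.natDegree + ∑ i, ρ i ≤ ∑ j, c j := by
  have hρ : ∑ i, ρ i ≤ ∑ j, c j := by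
    by_contra! hlt
    apply h0
    rw [det_apply]
    refine Finset.sum_eq_zero fun σ _ => ?_
    suffices ∏ i, A (σ i) i = 0 by rw [this, smul_zero]
    rw [Finset.prod_eq_zero_iff]
    by_contra! hne
    have := Finset.sum_le_sum fun i (_ : i ∈ Finset.univ) =>
      (hA (σ i) i).resolve_left (hne i (Finset.mem_univ i))
    rw [Finset.sum_add_distrib, Equiv.sum_comp σ ρ] at this
    omega
  suffices A.det.natDegree ≤ ∑ j, c j - ∑ i, ρ i by omega
  rw [det_apply]
  refine natDegree_sum_le_of_forall_le _ _ fun σ _ => ?_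
  refine (natDegree_smul_le _ _).trans ?_
  by_cases hz : ∏ i, A (σ i) i = 0
  · simp [hz]
  have hne : ∀ i, A (σ i) i ≠ 0 := fun i h => hz (Finset.prod_eq_zero (Finset.mem_univ i) h)
  have := Finset.sum_le_sum fun i (_ : i ∈ Finset.univ) => (hA (σ i) i).resolve_left (hne i)
  rw [Finset.sum_add_distrib, Equiv.sum_comp σ ρ] at this
  have h5 := natDegree_prod_le Finset.univ fun i => A (σ i) i
  omega

/-- The polynomial with coefficients `c 0, …, c (r - 1)`. -/
noncomputable def polyOfFin {r : ℕ} : (Fin r → K) →ₗ[K] K[X] where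
  toFun c := ∑ i, C (c i) * X ^ (i : ℕ)
  map_add' a b := by simp [add_mul, Finset.sum_add_distrib]
  map_smul' a b := by simp [Finset.smul_sum, smul_eq_C_mul, mul_assoc]

theorem polyOfFin_apply {r : ℕ} (c : Fin r → K) :
    polyOfFin c = ∑ i, C (c i) * X ^ (i : ℕ) := rfl

theorem polyOfFin_coeff {r : ℕ} (c : Fin r → K) (i : Fin r) : (polyOfFin c).coeff i = c i := by
  simp [polyOfFin_apply, coeff_X_pow, ← Fin.ext_iff]

theorem polyOfFin_coeff_of_le {r : ℕ} (c : Fin r → K) {j : ℕ} (h : r ≤ j) :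
    (polyOfFin c).coeff j = 0 := by
  simp only [polyOfFin_apply, finsetSum_coeff, coeff_C_mul, coeff_X_pow]
  exact Finset.sum_eq_zero fun i _ => by rw [if_neg (by omega), mul_zero]

theorem degree_polyOfFin_lt {r : ℕ} (c : Fin r → K) : (polyOfFin c).degree < r :=
  (degree_lt_iff_coeff_zero _ _).mpr fun _ h => polyOfFin_coeff_of_le c h

theorem polyOfFin_injective {r : ℕ} : Function.Injective (polyOfFin (K := K) (r := r)) := by
  intro a b h
  ext i
  rw [← polyOfFin_coeff a, h, polyOfFin_coeff]

theorem polyOfFin_coeff_self {r : ℕ} {p : K[X]} (hp : p.degree < r) :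
    polyOfFin (fun i : Fin r => p.coeff i) = p := by
  ext j
  rcases lt_or_ge j r with h | h
  · exact polyOfFin_coeff (fun i : Fin r => p.coeff i) ⟨j, h⟩
  · rw [polyOfFin_coeff_of_le _ h, (degree_lt_iff_coeff_zero _ _).mp hp j h]

/-- The Sylvester matrix of `f` and `g` in degrees `≥ k`, with `a` shifts of `f` and `b` shifts of
`g`. -/
noncomputable def truncSylvester {R : Type*} [CommRing R] (f g : R[X]) (k a b : ℕ) :
    Matrix (Fin a ⊕ Fin b) (Fin a ⊕ Fin b) R :=
  Matrix.of fun i j => (Sum.elim (fun l : Fin a => X ^ (l : ℕ) * f)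
    (fun l : Fin b => X ^ (l : ℕ) * g) j).coeff (k + (finSumFinEquiv i : ℕ))

theorem truncSylvester_map {R R' : Type*} [CommRing R] [CommRing R'] (φ : R →+* R') (f g : R[X])
    (k a b : ℕ) : (truncSylvester f g k a b).map φ = truncSylvester (f.map φ) (g.map φ) k a b := by
  ext i j
  rcases j with j | j <;>
    simp [truncSylvester, coeff_X_pow_mul', apply_ite φ]

theorem truncSylvester_mulVec (f g : K[X]) (k a b : ℕ) (u : Fin a → K) (v : Fin b → K)
    (i : Fin a ⊕ Fin b) :
    (truncSylvester f g k a b *ᵥ Sum.elim u v) i =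
      (polyOfFin u * f + polyOfFin v * g).coeff (k + (finSumFinEquiv i : ℕ)) := by
  simp only [truncSylvester, Matrix.mulVec, dotProduct, Matrix.of_apply, Fintype.sum_sum_type,
    Sum.elim_inl, Sum.elim_inr, polyOfFin_apply, Finset.sum_mul, coeff_add, finsetSum_coeff,
    mul_assoc, coeff_C_mul]
  simp only [mul_comm]

/-- A kernel vector is a combination uf + vg of degree below k. Being divisible by d, of degree k,
it is zero; coprimality then gives f' ∣ v, and deg v < b forces v = 0 and u = 0. -/
theorem det_truncSylvester_ne_zero {f g d f' g' : K[X]} {k a b : ℕ} (hd : d.Monic)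
    (hdk : d.natDegree = k) (hf : f = d * f') (hg : g = d * g') (hf' : f'.Monic) (hg' : g'.Monic)
    (hb : f'.natDegree = b) (ha : g'.natDegree = a) (hco : IsCoprime f' g') :
    (truncSylvester f g k a b).det ≠ 0 := by
  intro h0
  obtain ⟨w, hw0, hw⟩ := Matrix.exists_mulVec_eq_zero_iff.mpr h0
  obtain ⟨u, v, rfl⟩ : ∃ u v, w = Sum.elim u v :=
    ⟨fun i => w (Sum.inl i), fun i => w (Sum.inr i), by ext (i | i) <;> rfl⟩
  have hdeg1 : ∀ {p : K[X]} {x : ℕ}, p.degree < x → ∀ {r : K[X]}, (p * r).degree < x + r.natDegree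
      ∨ p * r = 0 := by
    intro p x hp r
    by_cases hr : p * r = 0
    · exact Or.inr hr
    left
    have hp0 : p ≠ 0 := left_ne_zero_of_mul hr
    have hr0 : r ≠ 0 := right_ne_zero_of_mul hr
    rw [← natDegree_lt_iff_degree_lt hp0] at hp
    rw [← Nat.cast_add, ← natDegree_lt_iff_degree_lt hr, natDegree_mul hp0 hr0]
    omega
  have hfn : f.natDegree = k + b := by rw [hf, hd.natDegree_mul hf', hdk, hb]
  have hgn : g.natDegree = k + a := by rw [hg, hd.natDegree_mul hg', hdk, ha]
  have hc1 : ∀ j, k + a + b ≤ j → (polyOfFin u * f + polyOfFin v * g).coeff j = 0 := by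
    intro j hj
    rw [coeff_add]
    have h1 : (polyOfFin u * f).coeff j = 0 := by
      rcases hdeg1 (degree_polyOfFin_lt u) (r := f) with h | h
      · rw [← Nat.cast_add] at h
        exact (degree_lt_iff_coeff_zero _ _).mp h j (by omega)
      · rw [h, coeff_zero]
    have h2 : (polyOfFin v * g).coeff j = 0 := by
      rcases hdeg1 (degree_polyOfFin_lt v) (r := g) with h | h
      · rw [← Nat.cast_add] at h
        exact (degree_lt_iff_coeff_zero _ _).mp h j (by omega)
      · rw [h, coeff_zero]
    rw [h1, h2, add_zero]
  have hlt : (polyOfFin u * f + polyOfFin v * g).degree < k := by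
    rw [degree_lt_iff_coeff_zero]
    intro j hj
    rcases lt_or_ge j (k + a + b) with h | h
    · have := congrFun hw (finSumFinEquiv.symm ⟨j - k, by omega⟩)
      rw [truncSylvester_mulVec, Equiv.apply_symm_apply] at this
      simpa [Nat.add_sub_cancel' hj] using this
    · exact hc1 j h
  have hz : polyOfFin u * f + polyOfFin v * g = 0 := by
    refine eq_zero_of_dvd_of_degree_lt (p := d) ?_ ?_
    · exact dvd_add (hf ▸ (Dvd.intro _ rfl).mul_left _) (hg ▸ (Dvd.intro _ rfl).mul_left _)
    · rwa [degree_eq_natDegree hd.ne_zero, hdk]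
  have hz' : polyOfFin u * f' + polyOfFin v * g' = 0 := by
    apply mul_left_cancel₀ hd.ne_zero
    rw [mul_zero, ← hz, hf, hg]
    ring
  have hv : polyOfFin v = 0 := by
    refine eq_zero_of_dvd_of_degree_lt (p := f') ?_ ?_
    · refine hco.dvd_of_dvd_mul_right ⟨-polyOfFin u, ?_⟩
      linear_combination hz'
    · rw [degree_eq_natDegree hf'.ne_zero, hb]
      exact degree_polyOfFin_lt v
  have hu : polyOfFin u = 0 := by
    rw [hv, zero_mul, add_zero] at hz'
    exact (mul_eq_zero.mp hz').resolve_right hf'.ne_zero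
  apply hw0
  have hu0 : u = 0 := polyOfFin_injective (by rw [hu, map_zero])
  have hv0 : v = 0 := polyOfFin_injective (by rw [hv, map_zero])
  rw [hu0, hv0]
  ext (i | i) <;> rfl

/-- The syzygy g'·f - f'·g = 0 and its multiples by X^i, i < r, fit in the allowed degrees. -/
theorem exists_linearIndependent_ker_truncSylvester {f g d f' g' : K[X]} {k a b r : ℕ}
    (hf : f = d * f') (hg : g = d * g') (hf' : f'.Monic) (hg' : g'.Monic)
    (hb : f'.natDegree + r = b) (ha : g'.natDegree + r = a) :
    ∃ w : Fin r → Fin a ⊕ Fin b → K, LinearIndependent K w ∧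
      ∀ i, truncSylvester f g k a b *ᵥ w i = 0 := by
  have hdeg : ∀ {p : K[X]} {e : ℕ}, p.Monic → p.natDegree + r = e → ∀ i : Fin r,
      (X ^ (i : ℕ) * p).degree < (e : WithBot ℕ) := by
    intro p e hp he i
    rw [← natDegree_lt_iff_degree_lt ((monic_X_pow _).mul hp).ne_zero,
      (monic_X_pow _).natDegree_mul hp, natDegree_X_pow]
    omega
  refine ⟨fun i => Sum.elim (fun j => (X ^ (i : ℕ) * g').coeff j)
    (fun j => (-(X ^ (i : ℕ) * f')).coeff j), ?_, fun i => ?_⟩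
  · rw [Fintype.linearIndependent_iff]
    intro c hc
    have hp : polyOfFin c * g' = 0 := by
      have h1 : (polyOfFin c * g').degree < a := by
        rw [polyOfFin_apply, Finset.sum_mul]
        refine (degree_sum_le _ _).trans_lt ((Finset.sup_lt_iff (WithBot.bot_lt_coe a)).mpr ?_)
        intro i _
        rw [mul_assoc, ← smul_eq_C_mul]
        exact (degree_smul_le _ _).trans_lt (hdeg hg' ha i)
      have h2 : (fun j : Fin a => (polyOfFin c * g').coeff j) = 0 := by
        ext j
        have h3 := congrFun hc (Sum.inl j)
        simpa [polyOfFin_apply, Finset.sum_mul, finsetSum_coeff, mul_assoc] using h3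
      rw [← polyOfFin_coeff_self h1, h2, map_zero]
    have h3 : polyOfFin c = 0 := (mul_eq_zero.mp hp).resolve_right hg'.ne_zero
    have h4 : c = 0 := polyOfFin_injective (by rw [h3, map_zero])
    exact fun i => congrFun h4 i
  · ext l
    rw [truncSylvester_mulVec, polyOfFin_coeff_self (hdeg hg' ha i), polyOfFin_coeff_self
      (by rw [degree_neg]; exact hdeg hf' hb i), hf, hg]
    have : X ^ (i : ℕ) * g' * (d * f') + -(X ^ (i : ℕ) * f') * (d * g') = 0 := by ring
    rw [this, coeff_zero, Pi.zero_apply]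

/-- Total degree bounds make row i of weight i and the l-th shift of f (resp. g) of weight b + l
(resp. a + l); the difference of the weight sums is 2ab - ab. -/
theorem natDegree_det_truncSylvester_le {f g : K[X][X]} {k a b : ℕ}
    (hf : ∀ i j, k + b < i + j → (f.coeff i).coeff j = 0)
    (hg : ∀ i j, k + a < i + j → (g.coeff i).coeff j = 0)
    (h0 : (truncSylvester f g k a b).det ≠ 0) :
    (truncSylvester f g k a b).det.natDegree ≤ a * b := by
  have key : ∀ (f : K[X][X]) (b l i : ℕ), (∀ i j, k + b < i + j → (f.coeff i).coeff j = 0) →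
      (X ^ l * f).coeff (k + i) = 0 ∨ ((X ^ l * f).coeff (k + i)).natDegree + i ≤ b + l := by
    intro f b l i hf
    rw [or_iff_not_imp_left]
    intro hne
    rw [coeff_X_pow_mul'] at hne ⊢
    split_ifs at hne ⊢ with hl
    · have h1 : (f.coeff (k + i - l)).coeff (f.coeff (k + i - l)).natDegree ≠ 0 := by
        rwa [coeff_natDegree, leadingCoeff_ne_zero]
      have h2 := mt (hf _ _) h1
      omega
    · exact absurd rfl hne
  have h := natDegree_det_add_le (truncSylvester f g k a b)
    (Sum.elim (fun l : Fin a => b + (l : ℕ)) (fun l : Fin b => a + (l : ℕ)))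
    (fun i => (finSumFinEquiv i : ℕ)) (by
      rintro i (j | j)
      · exact key f b j _ hf
      · exact key g a j _ hg) h0
  simp only [Fintype.sum_sum_type, Sum.elim_inl, Sum.elim_inr, Finset.sum_add_distrib,
    finSumFinEquiv_apply_left, finSumFinEquiv_apply_right, Fin.val_castAdd, Fin.val_natAdd,
    Finset.sum_const, Finset.card_univ, Fintype.card_fin, smul_eq_mul] at h
  nlinarith [mul_comm a b]

/-- The Szőnyi–Weiner lemma: the degree of the greatest common divisor of two bivariate polynomials
cannot jump too much when one variable is specialized. -/
theorem sum_natDegree_sub_le {n m : ℕ} {f g : K[X][X]} (hf : f.Monic) (hg : g.Monic)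
    (hfn : f.natDegree = n) (hgm : g.natDegree = m)
    (hft : ∀ i j, n < i + j → (f.coeff i).coeff j = 0)
    (hgt : ∀ i j, m < i + j → (g.coeff i).coeff j = 0)
    (d f' g' : K → K[X]) (hd : ∀ y, (d y).Monic)
    (hfd : ∀ y, f.map (evalRingHom y) = d y * f' y)
    (hgd : ∀ y, g.map (evalRingHom y) = d y * g' y) (y₀ : K) (hco : IsCoprime (f' y₀) (g' y₀))
    (s : Finset K) :
    ∑ y ∈ s, ((d y).natDegree - (d y₀).natDegree) ≤
      (n - (d y₀).natDegree) * (m - (d y₀).natDegree) := by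
  have hf' : ∀ y, (f' y).Monic := fun y => (hd y).of_mul_monic_left (hfd y ▸ hf.map _)
  have hg' : ∀ y, (g' y).Monic := fun y => (hd y).of_mul_monic_left (hgd y ▸ hg.map _)
  have hfn' : ∀ y, (d y).natDegree + (f' y).natDegree = n := fun y => by
    rw [← (hd y).natDegree_mul (hf' y), ← hfd, hf.natDegree_map, hfn]
  have hgn' : ∀ y, (d y).natDegree + (g' y).natDegree = m := fun y => by
    rw [← (hd y).natDegree_mul (hg' y), ← hgd, hg.natDegree_map, hgm]
  set k := (d y₀).natDegree with hk
  set b := n - k with hb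
  set a := m - k with ha
  have hmap : ∀ y, (truncSylvester f g k a b).map (eval y) =
      truncSylvester (d y * f' y) (d y * g' y) k a b := fun y => by
    rw [← hfd, ← hgd, ← truncSylvester_map]
    rfl
  -- Specializing at `y₀` suffices. Only there must the cofactors be coprime; elsewhere any monic
  -- common divisor will do.
  have hne : (truncSylvester f g k a b).det ≠ 0 := by
    intro h0
    have h1 := det_truncSylvester_ne_zero (k := k) (a := a) (b := b) (hd y₀) rfl rfl rfl (hf' y₀)
      (hg' y₀) (by have := hfn' y₀; omega) (by have := hgn' y₀; omega) hco
    apply h1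
    rw [← hmap, ← coe_evalRingHom, ← RingHom.mapMatrix_apply, ← RingHom.map_det, h0, map_zero]
  have hdvd : ∀ y, (X - C y) ^ ((d y).natDegree - k) ∣ (truncSylvester f g k a b).det := by
    intro y
    rcases le_or_gt (d y).natDegree k with h | h
    · rw [Nat.sub_eq_zero_of_le h, pow_zero]
      exact one_dvd _
    obtain ⟨w, hw, hker⟩ := exists_linearIndependent_ker_truncSylvester (k := k) (a := a) (b := b)
      (r := (d y).natDegree - k) (d := d y) rfl rfl (hf' y) (hg' y)
      (by have := hfn' y; omega) (by have := hgn' y; omega)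
    exact X_sub_C_pow_dvd_det _ y w hw (by rwa [hmap])
  have hprod : ∏ y ∈ s, (X - C y) ^ ((d y).natDegree - k) ∣ (truncSylvester f g k a b).det := by
    refine Finset.prod_dvd_of_coprime (fun x _ y _ hxy => ?_) fun y _ => hdvd y
    exact (isCoprime_X_sub_C_of_isUnit_sub (sub_ne_zero.mpr hxy).isUnit).pow
  have h1 := natDegree_le_of_dvd hprod hne
  rw [natDegree_prod_of_monic _ _ fun y _ => (monic_X_sub_C y).pow _] at h1
  simp only [natDegree_pow, natDegree_X_sub_C, mul_one] at h1
  rw [mul_comm b a]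
  have := hfn' y₀
  have := hgn' y₀
  refine h1.trans (natDegree_det_truncSylvester_le (fun i j h => hft i j (by omega))
    (fun i j h => hgt i j (by omega)) hne)

end Resultants

/-! ### Rédei polynomials and truncated multiplicities -/

section Redei

open Polynomial

variable {K ι : Type*} [Field K]

/-- The Rédei polynomial of the pairs `(u p, v p)` for `p ∈ T`. -/
noncomputable def redeiPoly (T : Finset ι) (u v : ι → K) : K[X][X] :=
  ∏ p ∈ T, (X - C (C (u p) + C (v p) * X))

theorem redeiPoly_monic (T : Finset ι) (u v : ι → K) : (redeiPoly T u v).Monic :=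
  monic_prod_of_monic _ _ fun _ _ => monic_X_sub_C _

theorem natDegree_redeiPoly (T : Finset ι) (u v : ι → K) :
    (redeiPoly T u v).natDegree = T.card := by
  rw [redeiPoly, natDegree_prod_of_monic _ _ fun _ _ => monic_X_sub_C _]
  simp only [natDegree_X_sub_C, Finset.sum_const, smul_eq_mul, mul_one]

/-- Each factor has total degree one in the two variables. -/
theorem coeff_coeff_redeiPoly (T : Finset ι) (u v : ι → K) :
    ∀ i j, T.card < i + j → ((redeiPoly T u v).coeff i).coeff j = 0 := by
  classical
  induction T using Finset.induction_on with
  | empty =>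
    intro i j h
    rw [redeiPoly, Finset.prod_empty, coeff_one]
    rw [Finset.card_empty] at h
    split_ifs with hi
    · rw [coeff_one, if_neg (by omega)]
    · rw [coeff_zero]
  | insert p T hp ih =>
    intro i j h
    rw [Finset.card_insert_of_notMem hp] at h
    have h1 : redeiPoly (insert p T) u v = redeiPoly T u v * X
        - redeiPoly T u v * C (C (u p)) - redeiPoly T u v * C (C (v p) * X) := by
      rw [redeiPoly, Finset.prod_insert hp, ← redeiPoly, C_add]
      ring
    have h2 : ((redeiPoly T u v * X).coeff i).coeff j = 0 := by
      rcases i with _ | i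
      · rw [coeff_mul_X_zero, coeff_zero]
      · rw [coeff_mul_X, ih i j (by omega)]
    have h3 : ((redeiPoly T u v).coeff i * (C (v p) * X)).coeff j = 0 := by
      rw [mul_left_comm, coeff_C_mul]
      rcases j with _ | j
      · rw [coeff_mul_X_zero, mul_zero]
      · rw [coeff_mul_X, ih i j (by omega), mul_zero]
    rw [h1, coeff_sub, coeff_sub, coeff_sub, coeff_sub, h2, coeff_mul_C,
      coeff_mul_C (redeiPoly T u v) i (C (v p) * X), h3, coeff_mul_C, ih i j (by omega)]
    ring

variable [Fintype K] [DecidableEq K]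

theorem redeiPoly_map (T : Finset ι) (u v : ι → K) (y : K) :
    (redeiPoly T u v).map (evalRingHom y) =
      ∏ z, (X - C z) ^ (T.filter fun p => u p + v p * y = z).card := by
  rw [redeiPoly, Polynomial.map_prod, ← Finset.prod_fiberwise T fun p => u p + v p * y]
  refine Finset.prod_congr rfl fun z _ => ?_
  rw [← Finset.prod_const]
  refine Finset.prod_congr rfl fun p hp => ?_
  rw [← (Finset.mem_filter.mp hp).2]
  simp

/-- For each slope, count the intercepts of a family of affine lines, each with multiplicity
truncated at two. Passing from one slope to the others, the counts cannot grow too much. -/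
theorem sum_sum_min_two_sub_le (T : Finset ι) (u v : ι → K) (k : K → ℕ)
    (hk : ∀ y, k y = ∑ z, min 2 (T.filter fun p => u p + v p * y = z).card) (y₀ : K)
    (s : Finset K) :
    ∑ y ∈ s, (k y - k y₀) ≤ (T.card - k y₀) * (2 * Fintype.card K - k y₀) := by
  let c : K → K → ℕ := fun y z => (T.filter fun p => u p + v p * y = z).card
  let E : (K → ℕ) → K[X] := fun e => ∏ z, (X - C z) ^ e z
  have hE : ∀ e, (E e).Monic := fun e => monic_prod_of_monic _ _ fun z _ => (monic_X_sub_C z).pow _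
  have hEmul : ∀ e e', E (e + e') = E e * E e' := fun e e' => by
    simp [E, pow_add, Finset.prod_mul_distrib]
  have hEdeg : ∀ e, (E e).natDegree = ∑ z, e z := fun e => by
    simp only [E]
    rw [natDegree_prod_of_monic _ _ fun z _ => (monic_X_sub_C z).pow _]
    simp
  have hk' : ∀ y, (E fun z => min 2 (c y z)).natDegree = k y := fun y => by rw [hEdeg, hk]
  have hfd : ∀ y, (redeiPoly T u v).map (evalRingHom y) =
      (E fun z => min 2 (c y z)) * E fun z => c y z - min 2 (c y z) := fun y => by
    rw [redeiPoly_map, ← hEmul]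
    refine Finset.prod_congr rfl fun z _ => ?_
    simp only [Pi.add_apply]
    congr 1
    simp only [c]
    omega
  -- The second polynomial is the square of ∏ (X - z), independent of the slope; `Fin 2` supplies
  -- the double roots that truncate multiplicities at two.
  have hgd : ∀ y, (redeiPoly (Finset.univ : Finset (K × Fin 2)) Prod.fst 0).map (evalRingHom y) =
      (E fun z => min 2 (c y z)) * E fun z => 2 - min 2 (c y z) := fun y => by
    rw [redeiPoly_map, ← hEmul]
    refine Finset.prod_congr rfl fun z _ => ?_
    congr 1
    have : (Finset.univ.filter fun p : K × Fin 2 => p.1 + (0 : K × Fin 2 → K) p * y = z) =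
        {z} ×ˢ Finset.univ := by
      ext ⟨a, b⟩
      simp [eq_comm]
    rw [this, Finset.card_product]
    simp
  have hco : IsCoprime (E fun z => c y₀ z - min 2 (c y₀ z)) (E fun z => 2 - min 2 (c y₀ z)) := by
    refine IsCoprime.prod_left fun z _ => IsCoprime.prod_right fun z' _ => ?_
    rcases eq_or_ne z z' with rfl | hz
    · rcases le_total 2 (c y₀ z) with h | h
      · simp only [min_eq_left h, Nat.sub_self, pow_zero, isCoprime_one_right]
      · simp only [min_eq_right h, Nat.sub_self, pow_zero, isCoprime_one_left]
    · exact (isCoprime_X_sub_C_of_isUnit_sub (sub_ne_zero.mpr hz).isUnit).pow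
  have h := sum_natDegree_sub_le (redeiPoly_monic T u v) (redeiPoly_monic _ _ _)
    (natDegree_redeiPoly _ _ _) (natDegree_redeiPoly _ _ _) (coeff_coeff_redeiPoly _ _ _)
    (coeff_coeff_redeiPoly _ _ _) _ _ _ (fun y => hE _) hfd hgd y₀ hco s
  simp only [hk', Finset.card_univ, Fintype.card_prod, Fintype.card_fin] at h
  rwa [mul_comm 2]

end Redei

/-! ### Coordinates adapted to a line -/

section Coordinates

open Matrix Projectivization Configuration Configuration.ofField

variable {F : Type*} [Field F]

/-- Complete a, b to a basis; by Cramer's rule the dual basis consists of cross products divided by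
the determinant. -/
theorem exists_dual_bases {a b : Fin 3 → F} (hab : crossProduct a b ≠ 0) :
    ∃ c α β h : Fin 3 → F, α ⬝ᵥ a = 1 ∧ α ⬝ᵥ b = 0 ∧ α ⬝ᵥ c = 0 ∧ β ⬝ᵥ a = 0 ∧ β ⬝ᵥ b = 1 ∧
      β ⬝ᵥ c = 0 ∧ h ⬝ᵥ a = 0 ∧ h ⬝ᵥ b = 0 ∧ h ⬝ᵥ c = 1 ∧
      (∀ w, w = (α ⬝ᵥ w) • a + (β ⬝ᵥ w) • b + (h ⬝ᵥ w) • c) ∧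
      ∀ x, x = (x ⬝ᵥ a) • α + (x ⬝ᵥ b) • β + (x ⬝ᵥ c) • h := by
  obtain ⟨c, hc⟩ : ∃ c, crossProduct a b ⬝ᵥ c ≠ 0 := by
    by_contra! h
    exact hab (dotProduct_eq_zero_iff.mp h)
  set D := crossProduct a b ⬝ᵥ c with hD
  have hD' : D = (a 1 * b 2 - a 2 * b 1) * c 0 + (a 2 * b 0 - a 0 * b 2) * c 1 +
      (a 0 * b 1 - a 1 * b 0) * c 2 := by
    rw [hD, cross_apply, dotProduct, Fin.sum_univ_three]
    simp
  have hD'' : D⁻¹ * D = 1 := inv_mul_cancel₀ hc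
  refine ⟨c, D⁻¹ • crossProduct b c, D⁻¹ • crossProduct c a, D⁻¹ • crossProduct a b,
    ?_, ?_, ?_, ?_, ?_, ?_, ?_, ?_, ?_, ?_, ?_⟩
  case refine_10 =>
    intro w
    ext i
    fin_cases i <;>
      simp [cross_apply, dotProduct, Fin.sum_univ_three]
    · linear_combination (D⁻¹ * w 0) * hD' - w 0 * hD''
    · linear_combination (D⁻¹ * w 1) * hD' - w 1 * hD''
    · linear_combination (D⁻¹ * w 2) * hD' - w 2 * hD''
  case refine_11 =>
    intro w
    ext i
    fin_cases i <;>
      simp [cross_apply, dotProduct, Fin.sum_univ_three]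
    · linear_combination (D⁻¹ * w 0) * hD' - w 0 * hD''
    · linear_combination (D⁻¹ * w 1) * hD' - w 1 * hD''
    · linear_combination (D⁻¹ * w 2) * hD' - w 2 * hD''
  all_goals
    simp [cross_apply, dotProduct, Fin.sum_univ_three]
    first
      | ring1
      | linear_combination hD'' - D⁻¹ * hD'

theorem mk_mem_mk_iff {v w : Fin 3 → F} (hv : v ≠ 0) (hw : w ≠ 0) :
    mk F v hv ∈ mk F w hw ↔ v ⬝ᵥ w = 0 := Iff.rfl

open scoped Classical in
/-- The Szőnyi–Weiner bound for a set of points of `PG(2, F)`, seen from the points of a line. -/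
theorem sum_sum_min_two_card_sub_le [Fintype F] [Fintype (PG2 F)] (S : Finset (PG2 F))
    (l R P₀ : PG2 F) (hR : R ∈ l) (hP : P₀ ∈ l) (hne : P₀ ≠ R) (k : PG2 F → ℕ)
    (hk : ∀ Q, k Q = ∑ m : PG2 F with Q ∈ m ∧ m ≠ l,
      min 2 ((S.filter (· ∉ l)).filter (· ∈ m)).card) :
    ∑ Q : PG2 F with Q ∈ l ∧ Q ≠ R, (k Q - k P₀) ≤
      ((S.filter (· ∉ l)).card - k P₀) * (2 * Fintype.card F - k P₀) := by
  induction R using Projectivization.ind with | h a ha =>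
  induction P₀ using Projectivization.ind with | h b hb =>
  induction l using Projectivization.ind with | h h' hh' =>
  have hab : crossProduct a b ≠ 0 := fun h0 =>
    hne ((mk_eq_mk_iff_crossProduct_eq_zero ha hb).mpr h0).symm
  obtain ⟨c, α, β, h, haa, hab', hac, hba, hbb, hbc, hha, hhb, hhc, hexp, hexp'⟩ :=
    exists_dual_bases hab
  have hh0 : h ≠ 0 := by
    rintro rfl
    simp at hhc
  have hl : mk F h' hh' = mk F h hh0 := by
    rw [mk_mem_mk_iff, dotProduct_comm] at hR hP
    have h1 := hexp' h'
    rw [hR, hP, zero_smul, zero_smul, zero_add, zero_add] at h1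
    exact (mk_eq_mk_iff' F _ _ hh' hh0).mpr ⟨_, h1.symm⟩
  rw [hl] at hk ⊢
  set l := mk F h hh0 with hldef
  have hpt0 : ∀ y : F, b - y • a ≠ 0 := fun y h0 => by
    have := congrArg (β ⬝ᵥ ·) h0
    simp [hbb, hba] at this
  let pt : F → PG2 F := fun y => mk F (b - y • a) (hpt0 y)
  have hln0 : ∀ y z : F, α + y • β - z • h ≠ 0 := fun y z h0 => by
    have := congrArg (· ⬝ᵥ a) h0
    simp [haa, hba, hha] at this
  -- `pt` parametrizes the points of `l` other than R, and `ln y` the lines through `pt y` other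
  -- than `l`.
  let ln : F → F → PG2 F := fun y z => mk F (α + y • β - z • h) (hln0 y z)
  have hpt : (Finset.univ.filter fun Q : PG2 F => Q ∈ l ∧ Q ≠ mk F a ha) =
      Finset.univ.image pt := by
    ext Q
    simp only [Finset.mem_filter, Finset.mem_univ, true_and, Finset.mem_image]
    constructor
    · rintro ⟨hQ, hQR⟩
      induction Q using Projectivization.ind with | h w hw =>
      rw [mk_mem_mk_iff, dotProduct_comm] at hQ
      have h1 := hexp w
      rw [hQ, zero_smul, add_zero] at h1
      have h2 : β ⬝ᵥ w ≠ 0 := by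
        intro h2
        rw [h2, zero_smul, add_zero] at h1
        exact hQR ((mk_eq_mk_iff' F _ _ hw ha).mpr ⟨_, h1.symm⟩)
      refine ⟨-(α ⬝ᵥ w) / (β ⬝ᵥ w), (mk_eq_mk_iff' F _ _ (hpt0 _) hw).mpr ⟨(β ⬝ᵥ w)⁻¹, ?_⟩⟩
      refine (congrArg (_ • ·) h1).trans ?_
      rw [smul_add, smul_smul, smul_smul, inv_mul_cancel₀ h2, one_smul, neg_div, neg_smul,
        sub_neg_eq_add, add_comm, div_eq_inv_mul]
    · rintro ⟨y, rfl⟩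
      refine ⟨?_, fun h0 => ?_⟩
      · rw [hldef, mk_mem_mk_iff, dotProduct_comm]
        simp [hha, hhb]
      · obtain ⟨t, ht⟩ := (mk_eq_mk_iff' F _ _ (hpt0 y) ha).mp h0
        have := congrArg (β ⬝ᵥ ·) ht
        simp [hba, hbb] at this
  have hptinj : Function.Injective pt := by
    intro y y' h0
    obtain ⟨t, ht⟩ := (mk_eq_mk_iff' F _ _ (hpt0 y) (hpt0 y')).mp h0
    have h1 := congrArg (β ⬝ᵥ ·) ht
    have h2 := congrArg (α ⬝ᵥ ·) ht
    simp [hba, hbb] at h1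
    simpa [h1, haa, hab', eq_comm] using h2
  have hln : ∀ y, (Finset.univ.filter fun m : PG2 F => pt y ∈ m ∧ m ≠ l) =
      Finset.univ.image (ln y) := by
    intro y
    ext m
    simp only [Finset.mem_filter, Finset.mem_univ, true_and, Finset.mem_image]
    constructor
    · rintro ⟨hm, hml⟩
      induction m using Projectivization.ind with | h x hx =>
      have h2 : x ⬝ᵥ b = y * x ⬝ᵥ a := by
        have : (b - y • a) ⬝ᵥ x = 0 := hm
        rw [dotProduct_comm, dotProduct_sub, dotProduct_smul, smul_eq_mul] at this
        linear_combination this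
      have h1 := hexp' x
      rw [h2] at h1
      have h3 : x ⬝ᵥ a ≠ 0 := by
        intro h3
        rw [h3, mul_zero, zero_smul, zero_smul, zero_add, zero_add] at h1
        exact hml ((mk_eq_mk_iff' F _ _ hx hh0).mpr ⟨_, h1.symm⟩)
      refine ⟨-(x ⬝ᵥ c) / (x ⬝ᵥ a), (mk_eq_mk_iff' F _ _ (hln0 _ _) hx).mpr ⟨(x ⬝ᵥ a)⁻¹, ?_⟩⟩
      refine (congrArg (_ • ·) h1).trans ?_
      rw [smul_add, smul_add, smul_smul, smul_smul, smul_smul, inv_mul_cancel₀ h3, one_smul,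
        neg_div, neg_smul, sub_neg_eq_add, div_eq_inv_mul, mul_comm y, inv_mul_cancel_left₀ h3]
    · rintro ⟨z, rfl⟩
      refine ⟨?_, fun h0 => ?_⟩
      · change (b - y • a) ⬝ᵥ (α + y • β - z • h) = 0
        rw [dotProduct_comm]
        simp [haa, hab', hba, hbb, hha, hhb]
      · obtain ⟨t, ht⟩ := (mk_eq_mk_iff' F _ _ (hln0 y z) hh0).mp h0
        have := congrArg (· ⬝ᵥ a) ht
        simp [haa, hba, hha] at this
  have hlninj : ∀ y, Function.Injective (ln y) := by
    intro y z z' h0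
    obtain ⟨t, ht⟩ := (mk_eq_mk_iff' F _ _ (hln0 y z) (hln0 y z')).mp h0
    have h1 := congrArg (· ⬝ᵥ a) ht
    have h2 := congrArg (· ⬝ᵥ c) ht
    simp [haa, hba, hha] at h1
    simpa [h1, hac, hbc, hhc, eq_comm] using h2
  have hP₀ : mk F b hb = pt 0 := by simp [pt]
  -- Off `l` the form h is nonzero, so dividing by it turns incidence with `ln y z` into u + v y =
  -- z.
  have hkey := sum_sum_min_two_sub_le (S.filter (· ∉ l))
    (fun p => (α ⬝ᵥ p.rep) / (h ⬝ᵥ p.rep)) (fun p => (β ⬝ᵥ p.rep) / (h ⬝ᵥ p.rep))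
    (fun y => k (pt y)) (fun y => by
      rw [hk, hln, Finset.sum_image fun _ _ _ _ h => hlninj y h]
      refine Finset.sum_congr rfl fun z _ => ?_
      congr 2
      refine Finset.filter_congr fun p hp => ?_
      have hp1 := (Finset.mem_filter.mp hp).2
      rw [← mk_rep p, mk_mem_mk_iff, dotProduct_comm] at hp1
      conv_lhs => rw [← mk_rep p]
      rw [mk_mem_mk_iff, dotProduct_comm, sub_dotProduct, add_dotProduct, smul_dotProduct,
        smul_dotProduct, smul_eq_mul, smul_eq_mul]
      field_simp
      rw [sub_eq_zero, mul_comm y, mul_comm z]) 0 Finset.univ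
  rw [hP₀, hpt, Finset.sum_image fun _ _ _ _ h => hptinj h]
  exact hkey

end Coordinates

/-! ### Counting tangents in a projective plane -/

section Planes

open Configuration Configuration.ProjectivePlane Finset
open scoped Classical

theorem card_points_on_two (P : Type*) {L : Type*} [Membership P L] [ProjectivePlane P L]
    [Fintype P] {l m : L} (h : l ≠ m) : #{p : P | p ∈ l ∧ p ∈ m} = 1 := by
  obtain ⟨p, hp, hu⟩ := HasPoints.existsUnique_point P L l m h
  refine card_eq_one.mpr ⟨p, ?_⟩
  ext r
  simp only [mem_filter, mem_univ, true_and, mem_singleton]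
  exact ⟨hu r, fun h => h ▸ hp⟩

theorem sum_card_filter_mem_of_notMem {P : Type*} (L : Type*) [Membership P L]
    [ProjectivePlane P L] [Fintype P] (T : Finset L) {l : L} (hl : l ∉ T) :
    ∑ Q : P with Q ∈ l, #{m ∈ T | Q ∈ m} = #T := by
  have h := sum_card_bipartiteAbove_eq_sum_card_bipartiteBelow
    (t := T) (s := ({p : P | p ∈ l} : Finset P)) (fun p m => p ∈ m)
  rw [card_eq_sum_ones]
  refine h.trans (sum_congr rfl fun m hm => ?_)
  rw [bipartiteBelow, filter_filter]
  exact card_points_on_two P fun h => hl (h ▸ hm)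

variable {P L : Type*} [Membership P L]

/-- The number of points of `S` on the line `l`. -/
noncomputable def secantCount (S : Finset P) (l : L) : ℕ := #{p ∈ S | p ∈ l}

variable (L) [Fintype L]

/-- The tangents to `S`. -/
noncomputable def tangents (S : Finset P) : Finset L := {l | secantCount S l = 1}

/-- The number of tangents to `S` through `Q`. -/
noncomputable def tangentCount (S : Finset P) (Q : P) : ℕ := #{l ∈ tangents L S | Q ∈ l}

section

variable {L}

theorem mem_tangents {S : Finset P} {l : L} : l ∈ tangents L S ↔ secantCount S l = 1 := by
  simp [tangents]

/-- Double counting: each tangent has one point of S, each point of S one tangent. -/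
theorem card_tangents {S : Finset P} (hS : ∀ p ∈ S, tangentCount L S p = 1) : #(tangents L S) = #S := by
  have h := sum_card_bipartiteAbove_eq_sum_card_bipartiteBelow
    (s := S) (t := tangents L S) (fun p m => p ∈ m)
  rw [card_eq_sum_ones, card_eq_sum_ones]
  refine Eq.trans (sum_congr rfl fun l hl => ?_) (h.symm.trans (sum_congr rfl hS))
  exact (mem_tangents.mp hl).symm

theorem isTangentLine_iff {S : Finset P} {l : L} : IsTangentLine (S : Set P) l ↔ l ∈ tangents L S := by
  rw [mem_tangents, secantCount, card_eq_one, IsTangentLine, ExistsUnique]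
  refine exists_congr fun p => ?_
  rw [eq_singleton_iff_unique_mem]
  simp

theorem tangentCount_eq_one_of_isSemioval {S : Finset P} (hS : IsSemioval L (S : Set P)) :
    ∀ p ∈ S, tangentCount L S p = 1 := by
  intro p hp
  obtain ⟨l, hl, hu⟩ := hS p hp
  refine card_eq_one.mpr ⟨l, ?_⟩
  ext m
  rw [mem_filter, mem_singleton, ← isTangentLine_iff]
  exact ⟨fun h => hu m ⟨h.2, h.1⟩, fun h => h ▸ ⟨hl.2, hl.1⟩⟩

end

variable [ProjectivePlane P L]

theorem card_lines_through_two {p r : P} (h : p ≠ r) : #{l : L | p ∈ l ∧ r ∈ l} = 1 := by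
  obtain ⟨l, hl, hu⟩ := HasLines.existsUnique_line P L p r h
  refine card_eq_one.mpr ⟨l, ?_⟩
  ext m
  simp only [mem_filter, mem_univ, true_and, mem_singleton]
  exact ⟨hu m, fun h => h ▸ hl⟩

theorem sum_secantCount_through (S : Finset P) {Q : P} (hQ : Q ∉ S) :
    ∑ m : L with Q ∈ m, secantCount S m = #S := by
  have h := sum_card_bipartiteAbove_eq_sum_card_bipartiteBelow
    (s := S) (t := ({m : L | Q ∈ m} : Finset L)) (fun p m => p ∈ m)
  rw [card_eq_sum_ones]
  refine h.symm.trans (sum_congr rfl fun p hp => ?_)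
  rw [bipartiteAbove, filter_filter]
  exact card_lines_through_two L fun h => hQ (h ▸ hp)

variable {L} in
theorem card_tangents_inter_le {S : Finset P} {Q R : P} (h : Q ≠ R) :
    #({m ∈ tangents L S | Q ∈ m} ∩ {m ∈ tangents L S | R ∈ m}) ≤ 1 := by
  rw [← card_lines_through_two L h]
  refine card_le_card fun m hm => ?_
  simp only [mem_inter, mem_filter, mem_univ, true_and] at hm ⊢
  exact ⟨hm.1.2, hm.2.2⟩

variable [Fintype P]

theorem card_lines_through (p : P) : #{l : L | p ∈ l} = order P L + 1 := by
  rw [← lineCount_eq L p, lineCount, Nat.card_eq_fintype_card, Fintype.card_subtype]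

variable (P) in
theorem card_points_on (l : L) : #{p : P | p ∈ l} = order P L + 1 := by
  rw [← pointCount_eq P l, pointCount, Nat.card_eq_fintype_card, Fintype.card_subtype]

variable {L} {S : Finset P}

/-- Counting each tangent's point twice, every line receives at least 2, while the total is n(q + 1)
+ n. -/
theorem le_mul_card_of_blocking (hS : ∀ p ∈ S, tangentCount L S p = 1)
    (hB : ∀ l : L, 1 ≤ secantCount S l) :
    2 * (order P L ^ 2 + order P L + 1) ≤ (order P L + 2) * #S := by
  have h := sum_card_bipartiteAbove_eq_sum_card_bipartiteBelow
    (s := S) (t := (univ : Finset L)) (fun p m => p ∈ m)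
  have h1 : ∑ p ∈ S, #((univ : Finset L).bipartiteAbove (fun p m => p ∈ m) p) =
      #S * (order P L + 1) := sum_const_nat fun p _ => card_lines_through L p
  have h2 : ∑ l : L, (secantCount S l + if secantCount S l = 1 then 1 else 0) =
      #S * (order P L + 1) + #S := by
    rw [sum_add_distrib, ← card_filter, ← h1, h]
    congr 1
    exact card_tangents hS
  have h3 : ∑ _l : L, 2 ≤ ∑ l : L, (secantCount S l + if secantCount S l = 1 then 1 else 0) :=
    sum_le_sum fun l _ => by
      have := hB l
      split_ifs <;> omega
  rw [h2, sum_const, card_univ, card_lines P L, smul_eq_mul] at h3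
  linarith

theorem two_mul_order_le (hS : ∀ p ∈ S, tangentCount L S p = 1)
    (hB : ∀ l : L, 1 ≤ secantCount S l) : 2 * order P L ≤ #S + 1 := by
  have h := le_mul_card_of_blocking hS hB
  by_contra! hlt
  have h1 : #S + 2 ≤ 2 * order P L := hlt
  nlinarith

/-- Otherwise all q + 1 lines through Q are tangent and n = q + 1, too small for the preceding
count. -/
theorem exists_two_le_secantCount (hS : ∀ p ∈ S, tangentCount L S p = 1)
    (hB : ∀ l : L, 1 ≤ secantCount S l) {Q : P} (hQ : Q ∉ S) :
    ∃ l : L, Q ∈ l ∧ 2 ≤ secantCount S l := by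
  by_contra! hlt
  have h1 := sum_secantCount_through L S hQ
  have h2 : ∑ m : L with Q ∈ m, secantCount S m = ∑ m : L with Q ∈ m, 1 :=
    sum_congr rfl fun m hm => by
      have := hlt m (mem_filter.mp hm).2
      have := hB m
      omega
  rw [h1, ← card_eq_sum_ones, card_lines_through] at h2
  have h3 := le_mul_card_of_blocking hS hB
  rw [h2] at h3
  nlinarith [one_lt_order P L]

/-- Each of the q lines m ≠ l through Q meets l only in Q ∉ S, so removing l loses nothing on m;
with s ≥ 1 points on m, min(2, s) + [s = 1] = 2. -/
theorem sum_min_two_add_tangentCount (hB : ∀ l : L, 1 ≤ secantCount S l) {l : L}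
    (hl : 2 ≤ secantCount S l) {Q : P} (hQl : Q ∈ l) (hQ : Q ∉ S) :
    ∑ m : L with Q ∈ m ∧ m ≠ l, min 2 #{p ∈ {p ∈ S | p ∉ l} | p ∈ m} + tangentCount L S Q =
      2 * order P L := by
  have h1 : tangentCount L S Q =
      ∑ m : L with Q ∈ m ∧ m ≠ l, if secantCount S m = 1 then 1 else 0 := by
    rw [← card_filter, tangentCount]
    congr 1
    ext m
    simp only [mem_filter, mem_univ, true_and, mem_tangents]
    constructor
    · rintro ⟨h, h'⟩
      refine ⟨⟨h', ?_⟩, h⟩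
      rintro rfl
      omega
    · exact fun h => ⟨h.2, h.1.1⟩
  have h2 : #{m : L | Q ∈ m ∧ m ≠ l} = order P L := by
    have : ({m : L | Q ∈ m ∧ m ≠ l} : Finset L) = ({m : L | Q ∈ m} : Finset L).erase l := by
      ext m
      simp [and_comm]
    rw [this, card_erase_of_mem (by simpa using hQl), card_lines_through, Nat.add_sub_cancel]
  rw [h1, ← sum_add_distrib, ← h2, mul_comm, ← smul_eq_mul, ← sum_const]
  refine sum_congr rfl fun m hm => ?_
  obtain ⟨hQm, hml⟩ := (mem_filter.mp hm).2
  have h3 : #{p ∈ {p ∈ S | p ∉ l} | p ∈ m} = secantCount S m := by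
    rw [secantCount, filter_filter]
    congr 1
    refine filter_congr fun p hp => ⟨fun h => h.2, fun h => ⟨fun h' => ?_, h⟩⟩
    rcases Nondegenerate.eq_or_eq h' hQl h hQm with rfl | rfl
    · exact hQ hp
    · exact hml rfl
  rw [h3]
  have := hB m
  split_ifs <;> omega

/-- The quadratic inequality satisfied by the number of tangents through a point off a blocking
semioval, as a consequence of the Szőnyi–Weiner bound. -/
theorem tangentCount_quadratic (hS : ∀ p ∈ S, tangentCount L S p = 1)
    (hB : ∀ l : L, 1 ≤ secantCount S l)
    (hW : ∀ (l : L) (R Q₀ : P), R ∈ l → Q₀ ∈ l → Q₀ ≠ R → ∀ k : P → ℕ,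
      (∀ Q, k Q = ∑ m : L with Q ∈ m ∧ m ≠ l, min 2 #{p ∈ {p ∈ S | p ∉ l} | p ∈ m}) →
      ∑ Q : P with Q ∈ l ∧ Q ≠ R, (k Q - k Q₀) ≤
        (#{p ∈ S | p ∉ l} - k Q₀) * (2 * order P L - k Q₀)) {Q₀ : P} (hQ₀ : Q₀ ∉ S) :
    (3 * order P L + 1 - #S) * (tangentCount L S Q₀ : ℤ) ≤
      (tangentCount L S Q₀ : ℤ) ^ 2 + #S - 2 := by
  obtain ⟨l, hQl, hl⟩ := exists_two_le_secantCount hS hB hQ₀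
  obtain ⟨R, hR⟩ : ({p ∈ S | p ∈ l} : Finset P).Nonempty := by
    rw [← card_pos]
    exact lt_of_lt_of_le two_pos hl
  obtain ⟨hRS, hRl⟩ := mem_filter.mp hR
  have hne : Q₀ ≠ R := fun h => hQ₀ (h ▸ hRS)
  let k : P → ℕ := fun Q => ∑ m : L with Q ∈ m ∧ m ≠ l, min 2 #{p ∈ {p ∈ S | p ∉ l} | p ∈ m}
  have hW := hW l R Q₀ hRl hQl hne k fun _ => rfl
  have hk : ∀ Q, Q ∈ l → Q ∉ S → k Q + tangentCount L S Q = 2 * order P L :=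
    fun Q h h' => sum_min_two_add_tangentCount hB hl h h'
  have hN : #{p ∈ S | p ∉ l} + secantCount S l = #S := by
    rw [add_comm]
    exact card_filter_add_card_filter_not _
  have hkN : k Q₀ ≤ #{p ∈ S | p ∉ l} := by
    rw [← sum_secantCount_through L {p ∈ S | p ∉ l} fun h => hQ₀ (mem_filter.mp h).1]
    refine (sum_le_sum fun m _ => min_le_right _ _).trans
      (sum_le_sum_of_subset fun m hm => ?_)
    simp only [mem_filter, mem_univ, true_and] at hm ⊢
    exact hm.1
  have hlT : l ∉ tangents L S := fun h => by
    have := mem_tangents.mp h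
    omega
  have hsum : ∑ Q : P with Q ∈ l ∧ Q ∉ S, tangentCount L S Q + secantCount S l = #S := by
    have h1 := sum_card_filter_mem_of_notMem (P := P) L _ hlT
    rw [card_tangents hS, ← sum_filter_not_add_sum_filter _ (· ∈ S), filter_filter,
      filter_filter] at h1
    rw [← h1]
    congr 1
    rw [secantCount, card_eq_sum_ones]
    refine sum_congr ?_ fun p hp => ?_
    · ext p
      simp [and_comm]
    · exact (hS p (mem_filter.mp hp).2.2).symm
  have hcard : #{Q : P | Q ∈ l ∧ Q ∉ S} + secantCount S l = order P L + 1 := by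
    rw [← card_points_on P L l, ← card_filter_add_card_filter_not (s := {p : P | p ∈ l}) (· ∈ S),
      filter_filter, filter_filter, add_comm, secantCount]
    congr 2
    ext p
    simp [and_comm]
  -- Since R ∈ S, the sum in `hW` covers all points of `l` off S; its truncated differences dominate
  -- the signed ones.
  have hW' : ∑ Q : P with Q ∈ l ∧ Q ∉ S, ((tangentCount L S Q₀ : ℤ) - tangentCount L S Q) ≤
      ((#{p ∈ S | p ∉ l} : ℤ) - k Q₀) * tangentCount L S Q₀ := by
    have h1 : ∑ Q : P with Q ∈ l ∧ Q ∉ S, ((tangentCount L S Q₀ : ℤ) - tangentCount L S Q) ≤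
        ((∑ Q : P with Q ∈ l ∧ Q ≠ R, (k Q - k Q₀) : ℕ) : ℤ) := by
      have h2 : ∑ Q : P with Q ∈ l ∧ Q ∉ S, (k Q - k Q₀) ≤
          ∑ Q : P with Q ∈ l ∧ Q ≠ R, (k Q - k Q₀) := by
        refine sum_le_sum_of_subset fun Q hQ => ?_
        simp only [mem_filter, mem_univ, true_and] at hQ ⊢
        exact ⟨hQ.1, fun h => hQ.2 (h ▸ hRS)⟩
      refine le_trans ?_ (Int.ofNat_le.mpr h2)
      push_cast
      refine sum_le_sum fun Q hQ => ?_
      simp only [mem_filter, mem_univ, true_and] at hQ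
      have := hk Q hQ.1 hQ.2
      have := hk Q₀ hQl hQ₀
      omega
    refine h1.trans ((Int.ofNat_le.mpr hW).trans (le_of_eq ?_))
    have := hk Q₀ hQl hQ₀
    rw [show 2 * order P L - k Q₀ = tangentCount L S Q₀ by omega]
    push_cast [Nat.cast_sub hkN]
    ring
  rw [sum_sub_distrib, sum_const, nsmul_eq_mul] at hW'
  have e1 : (k Q₀ : ℤ) = 2 * order P L - tangentCount L S Q₀ := by
    have := hk Q₀ hQl hQ₀
    omega
  have e2 : (#{p ∈ S | p ∉ l} : ℤ) = #S - secantCount S l := by omega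
  have e3 : ((∑ Q : P with Q ∈ l ∧ Q ∉ S, tangentCount L S Q : ℕ) : ℤ) =
      #S - secantCount S l := by omega
  have e4 : (#{Q : P | Q ∈ l ∧ Q ∉ S} : ℤ) = order P L + 1 - secantCount S l := by omega
  push_cast at e3
  rw [e1, e2, e3, e4] at hW'
  -- The size of l ∩ S cancels from the coefficient of t and survives only as a constant, where at
  -- least 2 is enough.
  have e5 : (2 : ℤ) ≤ secantCount S l := by exact_mod_cast hl
  linarith

/-- Each of the q + 1 lines through Q has at most q points of S, and a tangent falls short of this
by q - 1. -/
theorem tangentCount_mul_add_card_le {Q : P} (hQ : Q ∉ S) :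
    tangentCount L S Q * (order P L - 1) + #S ≤ (order P L + 1) * order P L := by
  rw [← sum_secantCount_through L S hQ]
  have h1 : tangentCount L S Q * (order P L - 1) =
      ∑ m : L with Q ∈ m, if secantCount S m = 1 then order P L - 1 else 0 := by
    rw [← sum_filter, sum_const, smul_eq_mul, tangentCount, tangents, filter_filter,
      filter_filter]
    simp only [and_comm]
  rw [h1, ← sum_add_distrib, ← card_lines_through L Q, ← smul_eq_mul, ← sum_const]
  refine sum_le_sum fun m hm => ?_
  have h2 : secantCount S m ≤ order P L := by
    have h3 : secantCount S m < #{p : P | p ∈ m} := by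
      refine card_lt_card ((ssubset_iff_of_subset ?_).mpr ⟨Q, by simpa using hm, ?_⟩)
      · exact fun p hp => by simpa using (mem_filter.mp hp).2
      · exact fun h => hQ (mem_filter.mp h).1
    rw [card_points_on] at h3
    omega
  have := one_lt_order P L
  split_ifs <;> omega

/-- The other n - 1 tangents meet l in its q + 1 points; at most one at each would give n ≤ q + 2.
-/
theorem exists_three_le_tangentCount (hS : ∀ p ∈ S, tangentCount L S p = 1)
    (hn : order P L + 2 < #S) {l : L} (hl : l ∈ tangents L S) :
    ∃ Q ∉ S, Q ∈ l ∧ 3 ≤ tangentCount L S Q := by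
  by_contra! hlt
  have h1 := sum_card_filter_mem_of_notMem (P := P) L _ (notMem_erase l (tangents L S))
  rw [card_erase_of_mem hl, card_tangents hS] at h1
  have h2 : ∑ Q : P with Q ∈ l, #{m ∈ (tangents L S).erase l | Q ∈ m} ≤
      ∑ Q : P with Q ∈ l, 1 := by
    refine sum_le_sum fun Q hQ => ?_
    have hQl := (mem_filter.mp hQ).2
    rw [filter_erase, card_erase_of_mem (mem_filter.mpr ⟨hl, hQl⟩)]
    change tangentCount L S Q - 1 ≤ 1
    by_cases hQS : Q ∈ S
    · rw [hS Q hQS]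
      omega
    · have := hlt Q hQS hQl
      omega
  rw [h1, ← card_eq_sum_ones, card_points_on] at h2
  omega

/-- Two points off `S` with `q` tangents each, where `S` has `2 q` points, are joined by a
tangent. -/
theorem tangents_inter_nonempty (hn : #S = 2 * order P L) {Q R : P} (hQ : Q ∉ S) (hR : R ∉ S)
    (hQR : Q ≠ R) (h : tangentCount L S Q = order P L) :
    ({m ∈ tangents L S | Q ∈ m} ∩ {m ∈ tangents L S | R ∈ m}).Nonempty := by
  obtain ⟨l, ⟨hQl, hRl⟩, -⟩ := HasLines.existsUnique_line P L Q R hQR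
  by_cases hl : l ∈ tangents L S
  · exact ⟨l, by simp [hl, hQl, hRl]⟩
  exfalso
  have h1 : {m ∈ tangents L S | Q ∈ m} = ({m : L | Q ∈ m} : Finset L).erase l := by
    refine eq_of_subset_of_card_le (fun m hm => ?_) ?_
    · obtain ⟨hm, hm'⟩ := mem_filter.mp hm
      simp only [mem_erase, mem_filter, mem_univ, true_and]
      exact ⟨fun h => hl (h ▸ hm), hm'⟩
    · rw [card_erase_of_mem (by simpa using hQl), card_lines_through]
      exact h.ge
  have h2 := sum_secantCount_through L S hQ
  rw [← add_sum_erase _ _ (by simpa using hQl : l ∈ ({m : L | Q ∈ m} : Finset L)), ← h1,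
    sum_congr rfl fun m hm => mem_tangents.mp (mem_filter.mp hm).1, ← card_eq_sum_ones] at h2
  have h3 : #{m ∈ tangents L S | Q ∈ m} = order P L := h
  -- The q tangents through Q account for q points of S, so the line QR must hold the other q;
  -- without Q and R it has only q - 1 points.
  have h4 : secantCount S l ≤ #((({p : P | p ∈ l} : Finset P).erase Q).erase R) := by
    refine card_le_card fun p hp => ?_
    obtain ⟨hpS, hpl⟩ := mem_filter.mp hp
    simp only [mem_erase, mem_filter, mem_univ, true_and]
    exact ⟨fun h => hR (h ▸ hpS), fun h => hQ (h ▸ hpS), hpl⟩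
  rw [card_erase_of_mem (by simp [hRl, hQR.symm]), card_erase_of_mem (by simp [hQl]),
    card_points_on] at h4
  have := one_lt_order P L
  omega

theorem nine_mul_order_le_of_quadratic (hS : ∀ p ∈ S, tangentCount L S p = 1)
    (hB : ∀ l : L, 1 ≤ secantCount S l)
    (hquad : ∀ Q ∉ S, (3 * order P L + 1 - #S) * (tangentCount L S Q : ℤ) ≤
      (tangentCount L S Q : ℤ) ^ 2 + #S - 2) : 9 * order P L ≤ 4 * #S + 12 := by
  by_contra! hlt
  have hlow := two_mul_order_le hS hB
  have hT := card_tangents hS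
  have hbig := fun l hl => exists_three_le_tangentCount (L := L) (l := l) hS (by omega) hl
  -- The quadratic is symmetric under t ↦ 3q + 1 - n - t, so its failure at t = 3 extends up to t =
  -- 3q - 2 - n.
  have hge : ∀ Q ∉ S, 3 ≤ tangentCount L S Q → 3 * order P L ≤ tangentCount L S Q + #S + 1 := by
    intro Q hQ h3
    have h := hquad Q hQ
    by_contra! hc
    zify at h3 hc hlt
    nlinarith [mul_nonneg (sub_nonneg.mpr h3)
      (by linarith : (0 : ℤ) ≤ 3 * order P L - 2 - #S - tangentCount L S Q)]
  have hle : ∀ Q ∉ S, ∀ x, #S + x * (order P L - 1) > (order P L + 1) * order P L →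
      tangentCount L S Q < x := by
    intro Q hQ x hx
    have h := tangentCount_mul_add_card_le (L := L) hQ
    by_contra! hc
    have := Nat.mul_le_mul_right (order P L - 1) hc
    omega
  obtain ⟨r, hr⟩ : ∃ r, order P L = r + 1 := ⟨order P L - 1, by omega⟩
  have hle1 : ∀ Q ∉ S, tangentCount L S Q ≤ order P L := fun Q hQ =>
    Nat.lt_succ_iff.mp (hle Q hQ _ (by
      rw [hr] at hlow hlt ⊢
      simp only [Nat.succ_eq_add_one, Nat.add_sub_cancel]
      nlinarith))
  obtain ⟨l₁, hl₁⟩ : (tangents L S).Nonempty := by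
    rw [← card_pos]
    omega
  obtain ⟨Q₁, hQ₁, -, hb₁⟩ := hbig l₁ hl₁
  -- If n = 2q - 1, the quadratic contradicts (t - 2)(q - t) ≥ 0.
  have h2q : 2 * order P L ≤ #S := by
    by_contra! hc
    have h1 := hquad Q₁ hQ₁
    have h2 := hle1 Q₁ hQ₁
    have h3 : #S + 1 = 2 * order P L := by omega
    zify at h2 h3 hb₁
    nlinarith [mul_nonneg (sub_nonneg.mpr h2)
      (by linarith : (0 : ℤ) ≤ (tangentCount L S Q₁ : ℤ) - 2)]
  obtain ⟨l₂, hl₂, hl₂'⟩ : ∃ l₂ ∈ tangents L S, l₂ ∉ ({m ∈ tangents L S | Q₁ ∈ m} : Finset L) := by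
    by_contra! hc
    have h1 : _ ≤ tangentCount L S Q₁ := card_le_card hc
    have := hle1 Q₁ hQ₁
    omega
  obtain ⟨Q₂, hQ₂, hQl₂, hb₂⟩ := hbig l₂ hl₂
  have h12 : Q₁ ≠ Q₂ := by
    rintro rfl
    exact hl₂' (mem_filter.mpr ⟨hl₂, hQl₂⟩)
  set T₁ : Finset L := {m ∈ tangents L S | Q₁ ∈ m} with hT₁
  set T₂ : Finset L := {m ∈ tangents L S | Q₂ ∈ m} with hT₂
  have hc₁ : #T₁ = tangentCount L S Q₁ := rfl
  have hc₂ : #T₂ = tangentCount L S Q₂ := rfl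
  have hu := card_union_add_card_inter T₁ T₂
  -- Two points cannot cover: if n = 2q they would need q tangents each but share one, and if n > 2q
  -- each has at most q - 1.
  by_cases hcov : tangents L S ⊆ T₁ ∪ T₂
  · have h1 := card_le_card hcov
    rcases h2q.eq_or_lt with heq | hgt
    · have h2 := hle1 Q₁ hQ₁
      have h3 := hle1 Q₂ hQ₂
      have h4 : 0 < #(T₁ ∩ T₂) := card_pos.mpr
        (tangents_inter_nonempty heq.symm hQ₁ hQ₂ h12 (by omega))
      omega
    · have hle2 : ∀ Q ∉ S, tangentCount L S Q < order P L := fun Q hQ =>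
        hle Q hQ _ (by rw [hr] at hgt ⊢; simp only [Nat.add_sub_cancel]; nlinarith)
      have h2 := hle2 Q₁ hQ₁
      have h3 := hle2 Q₂ hQ₂
      omega
  · obtain ⟨l₃, hl₃, hl₃'⟩ := not_subset.mp hcov
    obtain ⟨Q₃, hQ₃, hQl₃, hb₃⟩ := hbig l₃ hl₃
    rw [mem_union, not_or] at hl₃'
    have h13 : Q₁ ≠ Q₃ := by
      rintro rfl
      exact hl₃'.1 (mem_filter.mpr ⟨hl₃, hQl₃⟩)
    have h23 : Q₂ ≠ Q₃ := by
      rintro rfl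
      exact hl₃'.2 (mem_filter.mpr ⟨hl₃, hQl₃⟩)
    set T₃ : Finset L := {m ∈ tangents L S | Q₃ ∈ m} with hT₃
    have hc₃ : #T₃ = tangentCount L S Q₃ := rfl
    have hu' := card_union_add_card_inter (T₁ ∪ T₂) T₃
    rw [union_inter_distrib_right] at hu'
    have h1 := card_union_le (T₁ ∩ T₃) (T₂ ∩ T₃)
    have i12 : #(T₁ ∩ T₂) ≤ 1 := card_tangents_inter_le h12
    have i13 : #(T₁ ∩ T₃) ≤ 1 := card_tangents_inter_le h13
    have i23 : #(T₂ ∩ T₃) ≤ 1 := card_tangents_inter_le h23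
    have h2 : #((T₁ ∪ T₂) ∪ T₃) ≤ #(tangents L S) := card_le_card
      (union_subset (union_subset (filter_subset _ _) (filter_subset _ _)) (filter_subset _ _))
    have g1 := hge Q₁ hQ₁ hb₁
    have g2 := hge Q₂ hQ₂ hb₂
    have g3 := hge Q₃ hQ₃ hb₃
    omega

end Planes

open scoped Classical in
theorem order_PG2 (F : Type*) [Field F] [Finite F] :
    Configuration.ProjectivePlane.order (PG2 F) (PG2 F) = Nat.card F := by
  have : Fintype (PG2 F) := Fintype.ofFinite _
  have h1 := Configuration.ProjectivePlane.card_points (PG2 F) (PG2 F)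
  have h2 := Projectivization.card_of_finrank F (Fin 3 → F) (n := 3) (by simp)
  rw [← Nat.card_eq_fintype_card, h2] at h1
  simp only [Finset.sum_range_succ, Finset.sum_range_zero] at h1
  nlinarith

theorem mainTheorem6 (F : Type*) [Field F] [Finite F] (q : ℕ) (hF : Nat.card F = q) (hq : 4 ≤ q)
    (S : Set (PG2 F)) (hS : IsBlockingSemioval (PG2 F) S) :
    9 * (q : ℝ) / 4 - 3 ≤ (S.ncard : ℝ) := by
  classical
  have : Fintype F := Fintype.ofFinite F
  have : Fintype (PG2 F) := Fintype.ofFinite _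
  obtain ⟨S, rfl⟩ : ∃ S' : Finset (PG2 F), (S' : Set (PG2 F)) = S :=
    ⟨S.toFinite.toFinset, S.toFinite.coe_toFinset⟩
  have ht := tangentCount_eq_one_of_isSemioval hS.1
  have hB : ∀ l : PG2 F, 1 ≤ secantCount S l := by
    intro l
    have h := hS.2 l
    simp only [IsSkewLine, not_forall, not_not] at h
    obtain ⟨p, hp, hpl⟩ := h
    exact Finset.card_pos.mpr ⟨p, Finset.mem_filter.mpr ⟨hp, hpl⟩⟩
  have hord : Configuration.ProjectivePlane.order (PG2 F) (PG2 F) = q := by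
    rw [← hF, ← order_PG2 F]
  have h := nine_mul_order_le_of_quadratic ht hB fun Q hQ =>
    tangentCount_quadratic ht hB (fun l R Q₀ hR hQ₀ hne k hk => by
      rw [hord, ← hF, Nat.card_eq_fintype_card]
      convert sum_sum_min_two_card_sub_le S l R Q₀ hR hQ₀ hne k (by convert hk)) hQ
  rw [hord] at h
  rw [Set.ncard_coe_finset]
  have h' : (9 : ℝ) * q ≤ 4 * S.card + 12 := by exact_mod_cast h
  linarith
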